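/- Let $q\in\mathbb C$ be nonzero and not a root of unity (in particular $q\ne 1$). A power series $P(z,t)=\sum_{i,j\ge 0}p_{i,j}z^it^j\in\mathbb C[[z,t]]$ is a *Catalan power series* if $P(z,t)=t-z\tilde P(z,t)t^2$ for some power series $\tilde P$. A family $(e_k)_{k\ge 0}$ of nonzero power series in $\mathbb C[[z]]$ is a *$q$-Catalan basis associated to $P$* if $P$ is a Catalan power series, for all $i,k\ge 0$ the series $\sum_j p_{i,j}q^{kj}$ converges absolutely (so that $P(z,q^k)$, and in particular $P(z,1)$, is a well-defined power series in $z$), and $$\frac{e_k(qz)}{e_k(z)}=\frac{P(z,q^k)}{P(z,1)}\qquad(k\ge 0).$$ For $i=(i_1,i_2)\in\mathbb N^2$ put $\tilde e_i(z,t)=z^{i_1}\prod_{0\le j<i_2}P(q^jz,t)$. The *dual coefficients* are the complex numbers $(T_i)_{i\in\mathbb N^2}$ defined by $\sum_{i\in\mathbb N^2}T_i\,\tilde e_i(z,t)=t$. Put $$\Delta P(z,s,t)=\frac{P(z,s)-P(z,t)}{s-t}=\sum_{i,N\ge 0}p_{i,N+1}\,z^i\sum_{j+k=N}s^jt^k .$$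 The *dual forms* of $(e_k)$ are the linear forms $[e_n]$, $n\ge 0$, on $\mathbb C[[z]]$ such that $[e_n]e_k=\delta_{k,n}$ for all $k,n$ and $f=\sum_n([e_n]f)\,e_n$ for every $f\in\mathbb C[[z]]$, coefficient by coefficient. **Theorem.** Let $(e_k)$ be a $q$-Catalan basis associated to $P$, with dual coefficients $(T_i)$. Then: 1. For every $f\in\mathbb C[[z]]$ the series $$Tf(z)=\sum_{i\in\mathbb N^2}T_i\,\tilde e_i(z,1)\,f(q^{i_2}z)$$ converges absolutely, coefficient by coefficient, and so defines an operator $T$ on $\mathbb C[[z]]$. 2. For every $n\ge 0$, every $f\in\mathbb C[[z]]$ and every $m\le n$, the coefficient of $z^m$ in $$\Delta P(z,T,q^n)f(z)=\sum_{i,N\ge 0}p_{i,N+1}\,z^i\sum_{j+k=N}q^{nk}\,T^jf(z)$$ converges absolutely as a sum over $(i,N)$. 3. The dual forms of $(e_k)$ exist and are unique, and for every $n\ge 0$ and $f\in\mathbb C[[z]]$ $$[e_n]f=q^n\,[z^0]\left(\frac{\Delta P(z,T,q^n)f(z)}{e_n(qz)\,P(z,1)}\right),$$ where the quotient is a formal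 Laurent series in $z$ and $[z^0]$ is its constant coefficient, which depends only on the coefficients of $z^m$, $m\le n$, in $\Delta P(z,T,q^n)f(z)$. -/

import Mathlib

noncomputable section

namespace QCatalan

/-- Formal power series `P(z,t)` in two variables with complex coefficients, written as power
series in `z` (the outer variable) whose coefficients are power series in `t` (the inner one). -/
abbrev Series2 : Type := PowerSeries (PowerSeries ℂ)

/-- The coefficient `[z^a t^b] P(z,t)`. -/
def coeff2 (a b : ℕ) (P : Series2) : ℂ := PowerSeries.coeff b (PowerSeries.coeff a P)

/-- The series `z`. -/
def zVar : Series2 := PowerSeries.X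

/-- The series `t`. -/
def tVar : Series2 := PowerSeries.C (PowerSeries.X : PowerSeries ℂ)

/-- The substitution `P(c z, t)`. -/
def scaleZ (c : ℂ) (P : Series2) : Series2 :=
  PowerSeries.rescale (PowerSeries.C c : PowerSeries ℂ) P

/-- `P(z,c)` is defined: each coefficient `[z^a] P(z,t)`, a power series in `t`, converges
(absolutely, as always for unordered sums in `ℂ`) at `t = c`. -/
def ConvergesAt (P : Series2) (c : ℂ) : Prop :=
  ∀ a : ℕ, Summable fun b : ℕ => coeff2 a b P * c ^ b

/-- The power series `P(z,c)` in `z`. It is meaningful when `ConvergesAt P c`. -/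
def evalT (P : Series2) (c : ℂ) : PowerSeries ℂ :=
  PowerSeries.mk fun a => ∑' b : ℕ, coeff2 a b P * c ^ b

/-- `P` is a Catalan power series: `P(z,t) = t - z P̃(z,t) t²` for some power series `P̃`. -/
def IsCatalan (P : Series2) : Prop :=
  ∃ Pt : Series2, P = tVar - zVar * Pt * tVar ^ 2

/-- `(e_k)` is a `q`-Catalan basis associated to the Catalan power series `P`: for all `k`,
`e_k(qz) / e_k(z) = P(z,q^k) / P(z,1)`, a quotient of Laurent series, where it is understood that
`e_k ≠ 0` and that the values `P(z,q^k)` (with `P(z,1)` among them) are defined. -/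
structure IsQCatalanBasis (q : ℂ) (P : Series2) (e : ℕ → PowerSeries ℂ) : Prop where
  catalan : IsCatalan P
  converges : ∀ k : ℕ, ConvergesAt P (q ^ k)
  ne_zero : ∀ k : ℕ, e k ≠ 0
  ratio : ∀ k : ℕ,
    ((PowerSeries.rescale q (e k) : PowerSeries ℂ) : LaurentSeries ℂ) / (e k : LaurentSeries ℂ)
      = (evalT P (q ^ k) : LaurentSeries ℂ) / (evalT P 1 : LaurentSeries ℂ)

/-- The predual basis `ẽ_i(z,t) = z^{i₁} ∏_{0 ≤ j < i₂} P(q^j z, t)`, for `i = (i₁, i₂)`. -/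
def predual (q : ℂ) (P : Series2) (i : ℕ × ℕ) : Series2 :=
  zVar ^ i.1 * ∏ j ∈ Finset.range i.2, scaleZ (q ^ j) P

/-- `(T_i)` are the dual coefficients of `P`: `∑_i T_i ẽ_i(z,t) = t`, coefficient by coefficient. -/
def IsDualCoefficients (q : ℂ) (P : Series2) (T : ℕ × ℕ → ℂ) : Prop :=
  ∀ a b : ℕ, HasSum (fun i : ℕ × ℕ => T i * coeff2 a b (predual q P i)) (coeff2 a b tVar)

/-- The `i`-th term `T_i ẽ_i(z,1) f(q^{i₂} z)` of the operator `T`. -/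
def opTerm (q : ℂ) (P : Series2) (T : ℕ × ℕ → ℂ) (f : PowerSeries ℂ) (i : ℕ × ℕ) :
    PowerSeries ℂ :=
  T i • (evalT (predual q P i) 1 * PowerSeries.rescale (q ^ i.2) f)

/-- The operator `T f(z) = ∑_i T_i ẽ_i(z,1) f(q^{i₂} z)`, summed coefficient by coefficient. -/
def opT (q : ℂ) (P : Series2) (T : ℕ × ℕ → ℂ) (f : PowerSeries ℂ) : PowerSeries ℂ :=
  PowerSeries.mk fun m => ∑' i : ℕ × ℕ, PowerSeries.coeff m (opTerm q P T f i)

/-- Power series in `(z,s,t)`: outermost variable `z`, then `s`, innermost `t`. -/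
abbrev Series3 : Type := PowerSeries (PowerSeries (PowerSeries ℂ))

/-- The coefficient `[z^i s^j t^k] D(z,s,t)`. -/
def coeff3 (i j k : ℕ) (D : Series3) : ℂ :=
  PowerSeries.coeff k (PowerSeries.coeff j (PowerSeries.coeff i D))

/-- `ΔP(z,s,t) = (P(z,s) - P(z,t)) / (s - t)`. As `(s^n - t^n)/(s - t) = ∑_{j+k+1=n} s^j t^k`, the
coefficient of `z^i s^j t^k` is `[z^i t^{j+k+1}] P(z,t)`; see `deltaP_spec`. -/
def deltaP (P : Series2) : Series3 :=
  PowerSeries.mk fun i => PowerSeries.mk fun j => PowerSeries.mk fun k => coeff2 i (j + k + 1) P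

/-- `(s - t) ΔP(z,s,t) = P(z,s) - P(z,t)`. -/
theorem deltaP_spec (P : Series2) :
    PowerSeries.C ((PowerSeries.X : PowerSeries (PowerSeries ℂ))
        - PowerSeries.C (PowerSeries.X : PowerSeries ℂ)) * deltaP P
      = PowerSeries.map (PowerSeries.map (PowerSeries.C (R := ℂ))) P
        - PowerSeries.map (PowerSeries.C (R := PowerSeries ℂ)) P := by
  ext i j k
  rw [PowerSeries.coeff_C_mul]
  simp only [sub_mul, map_sub, PowerSeries.coeff_map, PowerSeries.coeff_C_mul, deltaP,
    PowerSeries.coeff_mk]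
  cases j <;> cases k <;>
    simp [PowerSeries.coeff_succ_X_mul, PowerSeries.coeff_C, coeff2, add_assoc, add_comm,
      add_left_comm]

/-- The terms of `D(z,S,c) f` of degree `i` in `z` and of total degree `N` in `(s,t)`:
`z^i ∑_{j+k=N} [z^i s^j t^k]D · c^k S^j f`. -/
def substTerm (D : Series3) (S : PowerSeries ℂ → PowerSeries ℂ) (c : ℂ) (f : PowerSeries ℂ)
    (p : ℕ × ℕ) : PowerSeries ℂ :=
  PowerSeries.X ^ p.1 *
    ∑ jk ∈ Finset.HasAntidiagonal.antidiagonal p.2, (coeff3 p.1 jk.1 jk.2 D * c ^ jk.2) • (S^[jk.1] f)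

/-- `D(z,S,c) f(z)` for an operator `S`, summed coefficient by coefficient. For `D = ΔP` this is
`∑_{i,N} p_{i,N+1} z^i ∑_{j+k=N} c^k S^j f`, where `p_{i,N+1} = [z^i t^{N+1}] P(z,t)`. -/
def substOp (D : Series3) (S : PowerSeries ℂ → PowerSeries ℂ) (c : ℂ) (f : PowerSeries ℂ) :
    PowerSeries ℂ :=
  PowerSeries.mk fun m => ∑' p : ℕ × ℕ, PowerSeries.coeff m (substTerm D S c f p)

/-- The linear forms `L n = [e_n]` are the dual forms of `(e_k)`: `[e_n] e_k = δ_{k,n}` and every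
power series `f` is decomposed as `f = ∑_n ([e_n] f) e_n`, coefficient by coefficient. -/
structure IsDualForms (e : ℕ → PowerSeries ℂ) (L : ℕ → PowerSeries ℂ →ₗ[ℂ] ℂ) : Prop where
  apply_basis : ∀ n k : ℕ, L n (e k) = if k = n then 1 else 0
  expansion : ∀ (f : PowerSeries ℂ) (m : ℕ),
    HasSum (fun n : ℕ => L n f * PowerSeries.coeff m (e n)) (PowerSeries.coeff m f)

end QCatalan

end

noncomputable section

namespace QCatalan

open PowerSeries Finset

/-! Let `E(z,t)` solve `t E(qz,t) = P(z,t) E(z,t)`, `E(0,t) = 1` (`qSol`). Multiplication by `E`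
telescopes the predual basis: `ẽ_i E = z^{i₁} t^{i₂} E(q^{i₂}z,t)`. With `R_a(t) = ∑_b T_{(a,b)}
t^b` and `E_l = [z^l]E`, the equation defining `T_i` becomes `∑_{a+l=m} R_a(q^l t) E_l(t) = t
E_m(t)` (`IsDualCoefficients.sum_rowSeries`). By induction every `R_a` converges at every `q^k`. At
`t = q^k` the equation says that `z^k E(z,q^k)` is an eigenvector, with eigenvalue `q^k`, of `F ↦ ∑
T_i z^{i₁} F(q^{i₂}z)` (`gaugedOp_X_pow_mul`). Conjugating this operator by `E(z,1)` gives `T`, and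
`E(z,1) e_k` is a multiple of `z^k E(z,q^k)` (`eq_smul_of_rescale_eq`). So `T e_k = q^k e_k`, and
`e_k` has order exactly `k`, whence the dual forms.

Up to order `n`, `ΔP(z,T,q^n)` therefore multiplies `e_l` by a divided difference of `P` if `l < n`,
fixes `e_n`, and kills the rest (`hasSum_substTerm`). The denominator is `P(z,q^n) e_n`. With `g =
e_l/e_n`, the quotient for `l < n` is a multiple of `g(qz) - g(z)`, which has no constant term; for
`l = n` it is `1/P(z,q^n)`, with constant term `q^{-n}` (`IsTriangular.triForm_eq`). -/

/-! ### Evaluation of series in one variable -/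

/-- The power series `f` converges absolutely at `c`. -/
def ConvAt (c : ℂ) (f : PowerSeries ℂ) : Prop := Summable fun b => coeff b f * c ^ b

/-- The value of the power series `f` at `c`. -/
def ev (c : ℂ) (f : PowerSeries ℂ) : ℂ := ∑' b, coeff b f * c ^ b

lemma coeff_mul_mul_pow (c : ℂ) (f g : PowerSeries ℂ) (n : ℕ) :
    coeff n (f * g) * c ^ n
      = ∑ x ∈ antidiagonal n, (coeff x.1 f * c ^ x.1) * (coeff x.2 g * c ^ x.2) := by
  rw [coeff_mul, sum_mul]
  refine sum_congr rfl fun x hx => ?_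
  rw [← mem_antidiagonal.1 hx, pow_add]
  ring

lemma ConvAt.mul {c : ℂ} {f g : PowerSeries ℂ} (hf : ConvAt c f) (hg : ConvAt c g) :
    ConvAt c (f * g) := by
  unfold ConvAt
  simp_rw [coeff_mul_mul_pow]
  exact (summable_norm_sum_mul_antidiagonal_of_summable_norm hf.norm hg.norm).of_norm

lemma ev_mul {c : ℂ} {f g : PowerSeries ℂ} (hf : ConvAt c f) (hg : ConvAt c g) :
    ev c (f * g) = ev c f * ev c g := by
  unfold ev
  simp_rw [coeff_mul_mul_pow]
  exact (tsum_mul_tsum_eq_tsum_sum_antidiagonal_of_summable_norm hf.norm hg.norm).symm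

lemma ConvAt.sum {ι : Type*} {c : ℂ} {s : Finset ι} {f : ι → PowerSeries ℂ}
    (h : ∀ i ∈ s, ConvAt c (f i)) : ConvAt c (∑ i ∈ s, f i) := by
  unfold ConvAt
  simp_rw [map_sum, sum_mul]
  exact summable_sum h

lemma ev_sum {ι : Type*} {c : ℂ} {s : Finset ι} {f : ι → PowerSeries ℂ}
    (h : ∀ i ∈ s, ConvAt c (f i)) : ev c (∑ i ∈ s, f i) = ∑ i ∈ s, ev c (f i) := by
  unfold ev
  simp_rw [map_sum, sum_mul]
  exact Summable.tsum_finsetSum h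

lemma ConvAt.sub {c : ℂ} {f g : PowerSeries ℂ} (hf : ConvAt c f) (hg : ConvAt c g) :
    ConvAt c (f - g) := by
  unfold ConvAt
  simp_rw [map_sub, sub_mul]
  exact Summable.sub hf hg

lemma ConvAt.const_mul {c : ℂ} {f : PowerSeries ℂ} (d : ℂ) (hf : ConvAt c f) :
    ConvAt c (C d * f) := by
  unfold ConvAt
  simp_rw [coeff_C_mul, mul_assoc]
  exact Summable.mul_left d hf

lemma ev_const_mul (c d : ℂ) (f : PowerSeries ℂ) : ev c (C d * f) = d * ev c f := by
  unfold ev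
  simp_rw [coeff_C_mul, mul_assoc]
  exact tsum_mul_left

lemma coeff_rescale_mul_pow (c d : ℂ) (f : PowerSeries ℂ) (b : ℕ) :
    coeff b (rescale d f) * c ^ b = coeff b f * (d * c) ^ b := by
  rw [coeff_rescale, mul_pow]; ring

lemma ConvAt.rescale {c d : ℂ} {f : PowerSeries ℂ} (hf : ConvAt (d * c) f) :
    ConvAt c (rescale d f) := by
  unfold ConvAt
  simp_rw [coeff_rescale_mul_pow]
  exact hf

lemma ev_rescale (c d : ℂ) (f : PowerSeries ℂ) : ev c (rescale d f) = ev (d * c) f := by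
  unfold ev
  simp_rw [coeff_rescale_mul_pow]

lemma hasSum_monomial (c : ℂ) (n : ℕ) :
    HasSum (fun b => coeff b (X ^ n : PowerSeries ℂ) * c ^ b) (c ^ n) := by
  convert hasSum_single n fun b hb => ?_ using 1
  · simp
  · simp [coeff_X_pow, hb]

lemma convAt_X_pow (c : ℂ) (n : ℕ) : ConvAt c (X ^ n) := (hasSum_monomial c n).summable

lemma ev_X_pow (c : ℂ) (n : ℕ) : ev c (X ^ n) = c ^ n := (hasSum_monomial c n).tsum_eq

lemma convAt_one (c : ℂ) : ConvAt c 1 := by simpa using convAt_X_pow c 0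

lemma ev_one (c : ℂ) : ev c 1 = 1 := by simpa using ev_X_pow c 0

lemma convAt_X (c : ℂ) : ConvAt c X := by simpa using convAt_X_pow c 1

lemma ev_X (c : ℂ) : ev c X = c := by simpa using ev_X_pow c 1

lemma convAt_zero (c : ℂ) : ConvAt c 0 := by
  simp [ConvAt]

/-! ### Evaluation of `P(z,t)` at `t = c` -/

lemma coeff_evalT (P : Series2) (c : ℂ) (a : ℕ) : coeff a (evalT P c) = ev c (coeff a P) := by
  simp [evalT, ev, coeff2]

lemma ConvergesAt.coeff {P : Series2} {c : ℂ} (h : ConvergesAt P c) (a : ℕ) :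
    ConvAt c (coeff a P) := h a

lemma ConvergesAt.mul {A B : Series2} {c : ℂ} (hA : ConvergesAt A c) (hB : ConvergesAt B c) :
    ConvergesAt (A * B) c := by
  intro a
  change ConvAt c (PowerSeries.coeff a (A * B))
  rw [coeff_mul]
  exact ConvAt.sum fun x _ => (hA.coeff _).mul (hB.coeff _)

lemma evalT_mul {A B : Series2} {c : ℂ} (hA : ConvergesAt A c) (hB : ConvergesAt B c) :
    evalT (A * B) c = evalT A c * evalT B c := by
  ext a
  rw [coeff_evalT, coeff_mul, coeff_mul, ev_sum fun x _ => (hA.coeff _).mul (hB.coeff _)]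
  exact sum_congr rfl fun x _ => by
    rw [ev_mul (hA.coeff _) (hB.coeff _), coeff_evalT, coeff_evalT]

lemma coeff_scaleZ (d : ℂ) (A : Series2) (a : ℕ) :
    coeff a (scaleZ d A) = C (d ^ a) * coeff a A := by
  rw [scaleZ, coeff_rescale, map_pow]

lemma ConvergesAt.scaleZ {A : Series2} {c : ℂ} (hA : ConvergesAt A c) (d : ℂ) :
    ConvergesAt (scaleZ d A) c := by
  intro a
  change ConvAt c (PowerSeries.coeff a (QCatalan.scaleZ d A))
  rw [coeff_scaleZ]
  exact (hA.coeff a).const_mul _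

lemma evalT_scaleZ (A : Series2) (c d : ℂ) : evalT (scaleZ d A) c = rescale d (evalT A c) := by
  ext a
  rw [coeff_evalT, coeff_scaleZ, ev_const_mul, coeff_rescale, coeff_evalT]

lemma convergesAt_C {f : PowerSeries ℂ} {c : ℂ} (hf : ConvAt c f) :
    ConvergesAt (C f : Series2) c := by
  intro a
  change ConvAt c (PowerSeries.coeff a (C f : Series2))
  rw [coeff_C]
  split_ifs
  exacts [hf, convAt_zero c]

lemma evalT_C (f : PowerSeries ℂ) (c : ℂ) : evalT (C f : Series2) c = C (ev c f) := by
  ext a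
  rw [coeff_evalT, coeff_C, coeff_C]
  split_ifs
  · rfl
  · simp [ev]

lemma convergesAt_zVar_pow (c : ℂ) (n : ℕ) : ConvergesAt (zVar ^ n) c := by
  intro a
  change ConvAt c (PowerSeries.coeff a (zVar ^ n))
  rw [zVar, coeff_X_pow]
  split_ifs
  exacts [convAt_one c, convAt_zero c]

lemma evalT_zVar_pow (c : ℂ) (n : ℕ) : evalT (zVar ^ n) c = X ^ n := by
  ext a
  rw [coeff_evalT, zVar, coeff_X_pow, coeff_X_pow]
  split_ifs
  · exact ev_one c
  · simp [ev]

lemma scaleZ_mul (c : ℂ) (A B : Series2) : scaleZ c (A * B) = scaleZ c A * scaleZ c B :=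
  map_mul _ _ _

lemma scaleZ_scaleZ (c d : ℂ) (A : Series2) : scaleZ c (scaleZ d A) = scaleZ (c * d) A := by
  ext1 a
  rw [coeff_scaleZ, coeff_scaleZ, coeff_scaleZ, ← mul_assoc, ← map_mul, mul_pow]

lemma convergesAt_one (c : ℂ) : ConvergesAt 1 c := by
  simpa using convergesAt_zVar_pow c 0

lemma ConvergesAt.predual {P : Series2} {c : ℂ} (hP : ConvergesAt P c) (q : ℂ) (i : ℕ × ℕ) :
    ConvergesAt (predual q P i) c := by
  refine (convergesAt_zVar_pow c _).mul ?_
  induction i.2 with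
  | zero => simpa using convergesAt_one c
  | succ n ih => rw [prod_range_succ]; exact ih.mul (hP.scaleZ _)

/-! ### The gauge `E` and its q-difference equation -/

/-- The quotient `P(z,t) / t`. -/
def divT (P : Series2) : Series2 := mk fun a => mk fun b => coeff2 a (b + 1) P

lemma ConvergesAt.divT {P : Series2} {c : ℂ} (hc : c ≠ 0) (hP : ConvergesAt P c) :
    ConvergesAt (divT P) c := by
  intro a
  have h := ((summable_nat_add_iff 1).2 (hP a)).mul_right c⁻¹
  refine h.congr fun b => ?_
  simp only [coeff2, QCatalan.divT, coeff_mk]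
  field_simp
  ring

lemma IsCatalan.coeff_zero {P : Series2} (hP : IsCatalan P) : coeff 0 P = X := by
  obtain ⟨Pt, rfl⟩ := hP
  simp [tVar, zVar, coeff_zero_eq_constantCoeff]

lemma IsCatalan.coeff2_zero {P : Series2} (hP : IsCatalan P) (a : ℕ) : coeff2 a 0 P = 0 := by
  obtain ⟨Pt, rfl⟩ := hP
  rw [coeff2, tVar, ← map_pow, map_sub, coeff_mul_C, coeff_C]
  split_ifs <;> simp [coeff_zero_eq_constantCoeff]

lemma IsCatalan.tVar_mul_divT {P : Series2} (hP : IsCatalan P) : tVar * divT P = P := by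
  ext a b
  rw [tVar, coeff_C_mul]
  cases b with
  | zero => simpa [coeff_zero_eq_constantCoeff, coeff2] using (hP.coeff2_zero a).symm
  | succ b => simp [coeff_succ_X_mul, divT, coeff2]

lemma IsCatalan.coeff_zero_divT {P : Series2} (hP : IsCatalan P) : coeff 0 (divT P) = 1 := by
  ext b
  simp only [divT, coeff_mk, coeff2, hP.coeff_zero, coeff_X, coeff_one, Nat.add_eq_right]

/-- The coefficients of the solution `E` of `E(qz) = U(z) E(z)`, `E(0) = 1`. -/
def qSolCoeff (q : ℂ) (U : Series2) : ℕ → PowerSeries ℂ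
  | 0 => 1
  | m + 1 => C ((q ^ (m + 1) - 1)⁻¹) *
      ∑ l : Fin (m + 1), coeff (m + 1 - l) U * qSolCoeff q U l

/-- The solution `E` of `E(qz) = U(z) E(z)`, `E(0) = 1`. -/
def qSol (q : ℂ) (U : Series2) : Series2 := mk (qSolCoeff q U)

lemma coeff_zero_qSol (q : ℂ) (U : Series2) : coeff 0 (qSol q U) = 1 := by
  simp only [qSol, coeff_mk, qSolCoeff]

lemma coeff_succ_qSol (q : ℂ) (U : Series2) (m : ℕ) :
    coeff (m + 1) (qSol q U) = C ((q ^ (m + 1) - 1)⁻¹) *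
      ∑ l ∈ range (m + 1), coeff (m + 1 - l) U * coeff l (qSol q U) := by
  rw [Finset.sum_range]
  simp only [qSol, coeff_mk, qSolCoeff]

/-- Since `U(0,t) = 1`, the coefficient of `z^m` in the equation reads `(q^m - 1) E_m = ∑_{l<m}
U_{m-l} E_l`, which is solvable because `q^m ≠ 1` for `m > 0`. -/
lemma scaleZ_qSol {q : ℂ} (hq : ∀ k : ℕ, 0 < k → q ^ k ≠ 1) {U : Series2} (hU : coeff 0 U = 1) :
    scaleZ q (qSol q U) = U * qSol q U := by
  ext1 m
  rw [coeff_scaleZ]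
  cases m with
  | zero => simp [coeff_mul, hU, coeff_zero_qSol]
  | succ m =>
    have h := sub_ne_zero.2 (hq (m + 1) m.succ_pos)
    rw [mul_comm U, coeff_mul, Finset.Nat.sum_antidiagonal_eq_sum_range_succ_mk, sum_range_succ]
    have key : ∑ l ∈ range (m + 1), coeff l (qSol q U) * coeff (m + 1 - l) U
        = C (q ^ (m + 1) - 1) * coeff (m + 1) (qSol q U) := by
      rw [coeff_succ_qSol, ← mul_assoc, ← map_mul, mul_inv_cancel₀ h, map_one, one_mul]
      exact sum_congr rfl fun _ _ => mul_comm _ _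
    rw [key, Nat.sub_self, hU, map_sub, map_one]
    ring

lemma ConvergesAt.qSol {q c : ℂ} {U : Series2} (hU : ConvergesAt U c) :
    ConvergesAt (qSol q U) c := by
  intro m
  change ConvAt c (PowerSeries.coeff m (QCatalan.qSol q U))
  induction m using Nat.strong_induction_on with
  | _ m ih =>
    cases m with
    | zero => rw [coeff_zero_qSol]; exact convAt_one c
    | succ m =>
      rw [coeff_succ_qSol]
      exact (ConvAt.sum fun l hl => (hU.coeff _).mul (ih l (mem_range.1 hl))).const_mul _

/-- Telescoping: each factor `P(q^j z,t)` turns `E(q^j z,t)` into `t E(q^{j+1} z,t)`. -/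
lemma predual_mul_of_scaleZ {q : ℂ} {P E : Series2} (h : P * E = tVar * scaleZ q E) (i : ℕ × ℕ) :
    predual q P i * E = zVar ^ i.1 * (tVar ^ i.2 * scaleZ (q ^ i.2) E) := by
  rw [predual, mul_assoc]
  congr 1
  induction i.2 with
  | zero => simp [scaleZ]
  | succ n ih =>
    have ht : scaleZ (q ^ n) tVar = tVar := by
      ext1 a
      rw [coeff_scaleZ, tVar, coeff_C]
      split_ifs with ha <;> simp [ha]
    rw [prod_range_succ, mul_right_comm, ih]
    calc _ = tVar ^ n * scaleZ (q ^ n) (P * E) := by rw [scaleZ_mul]; ring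
      _ = _ := by rw [h, scaleZ_mul, scaleZ_scaleZ, ht, pow_succ, pow_succ, mul_assoc]

/-! ### Generating functions of the dual coefficients -/

lemma coeff_X_pow_mul_eq_sum {R : Type*} [CommSemiring R] (i m : ℕ) (g : PowerSeries R) :
    coeff m (X ^ i * g)
      = ∑ x ∈ antidiagonal m, if i = x.1 then coeff x.2 g else 0 := by
  rw [coeff_mul]
  refine sum_congr rfl fun x _ => ?_
  rw [coeff_X_pow]
  by_cases h : x.1 = i
  · simp [h]
  · simp [h, Ne.symm h]

/-- Row-wise summation of the coefficients of a family `z^i G(i,b)`. -/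
lemma hasSum_coeff_X_pow_mul {G : ℕ × ℕ → PowerSeries ℂ} {s : ℕ → ℕ → ℂ} {m : ℕ}
    (h : ∀ a l, a + l = m → HasSum (fun b => coeff l (G (a, b))) (s a l)) :
    HasSum (fun p : ℕ × ℕ => coeff m (X ^ p.1 * G p))
      (∑ x ∈ antidiagonal m, s x.1 x.2) := by
  simp_rw [coeff_X_pow_mul_eq_sum]
  refine hasSum_sum fun x hx => ?_
  have hinj : Function.Injective fun b : ℕ => (x.1, b) := fun b c hbc => (Prod.mk.inj hbc).2
  refine (hinj.hasSum_iff fun p hp => ?_).1 ?_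
  · refine if_neg fun hpx => hp ⟨p.2, ?_⟩
    rw [← hpx]
  · simpa [Function.comp_def] using h x.1 x.2 (mem_antidiagonal.1 hx)

lemma HasSum.coeff_mul_left {ι : Type*} {g : ι → PowerSeries ℂ} {G : PowerSeries ℂ}
    (h : ∀ m, HasSum (fun i => coeff m (g i)) (coeff m G)) (A : PowerSeries ℂ) (m : ℕ) :
    HasSum (fun i => coeff m (A * g i)) (coeff m (A * G)) := by
  simp_rw [coeff_mul]
  exact hasSum_sum fun x _ => (h x.2).mul_left _

/-- The generating function `∑_b T_{(a,b)} t^b`. -/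
def rowSeries (T : ℕ × ℕ → ℂ) (a : ℕ) : PowerSeries ℂ := mk fun b => T (a, b)

lemma coeff2_tVar_pow_mul (A : Series2) (a b n : ℕ) :
    coeff2 a b (tVar ^ n * A) = coeff b (X ^ n * coeff a A) := by
  rw [coeff2, tVar, ← map_pow, coeff_C_mul]

/-- The functional equation of the dual coefficients, in terms of the gauge `E`. -/
lemma IsDualCoefficients.sum_rowSeries {q : ℂ} {P E : Series2} {T : ℕ × ℕ → ℂ}
    (hT : IsDualCoefficients q P T) (h : P * E = tVar * scaleZ q E) (m : ℕ) :
    ∑ x ∈ antidiagonal m, rescale (q ^ x.2) (rowSeries T x.1) * coeff x.2 E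
      = X * coeff m E := by
  ext b
  -- The defining sum may be multiplied by `E`, as each coefficient of a product involves finitely
  -- many coefficients of the factors.
  have h1 : HasSum (fun i => T i * coeff2 m b (predual q P i * E)) (coeff2 m b (tVar * E)) := by
    have key : ∀ A : Series2, coeff2 m b (A * E) = ∑ x ∈ antidiagonal m, ∑ y ∈ antidiagonal b,
        coeff2 x.1 y.1 A * coeff2 x.2 y.2 E := by
      intro A
      simp only [coeff2, coeff_mul, map_sum]
    simp_rw [key, mul_sum, ← mul_assoc]
    exact hasSum_sum fun x _ => hasSum_sum fun y _ => (hT _ _).mul_right _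
  -- After telescoping, only finitely many `i` contribute to a given coefficient.
  have h2 : HasSum (fun i => T i * coeff2 m b (predual q P i * E))
      (∑ x ∈ antidiagonal m, ∑ y ∈ antidiagonal b,
        T (x.1, y.1) * (q ^ y.1) ^ x.2 * coeff2 x.2 y.2 E) := by
    have key : ∀ i : ℕ × ℕ, T i * coeff2 m b (predual q P i * E)
        = ∑ x ∈ antidiagonal m, ∑ y ∈ antidiagonal b,
          if i = (x.1, y.1) then T (x.1, y.1) * (q ^ y.1) ^ x.2 * coeff2 x.2 y.2 E else 0 := by
      intro i
      rw [predual_mul_of_scaleZ h, coeff2, zVar, coeff_X_pow_mul_eq_sum, map_sum, mul_sum]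
      refine sum_congr rfl fun x _ => ?_
      split_ifs with hx
      · have := coeff2_tVar_pow_mul (scaleZ (q ^ i.2) E) x.2 b i.2
        rw [coeff2] at this
        rw [this, coeff_X_pow_mul_eq_sum, mul_sum]
        refine sum_congr rfl fun y _ => ?_
        rw [coeff_scaleZ, coeff_C_mul]
        by_cases hy : i.2 = y.1
        · have hi : i = (x.1, y.1) := Prod.ext hx hy
          simp [hi, coeff2, mul_assoc]
        · simp [hy, Prod.ext_iff]
      · rw [map_zero, mul_zero]
        exact (sum_eq_zero fun y _ => if_neg fun hi => hx (by rw [hi])).symm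
    simp_rw [key]
    refine hasSum_sum fun x _ => hasSum_sum fun y _ => ?_
    exact hasSum_ite_eq _ _
  have h3 := h2.unique h1
  have h4 := coeff2_tVar_pow_mul E m b 1
  rw [pow_one, pow_one] at h4
  rw [← h4, ← h3, map_sum]
  refine sum_congr rfl fun x _ => ?_
  rw [coeff_mul]
  refine sum_congr rfl fun y _ => ?_
  rw [coeff_rescale, rowSeries, coeff_mk, coeff2, ← pow_mul, ← pow_mul, mul_comm x.2]
  ring

/-- As `E_0 = 1`, the functional equation expresses `R_m(t)` through `t E_m(t)` and the `R_a(q^{m-a}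
t)` with `a < m`; the induction must cover all `q^k` at once because of this dilation. -/
lemma IsDualCoefficients.convAt {q : ℂ} {P E : Series2} {T : ℕ × ℕ → ℂ}
    (hT : IsDualCoefficients q P T) (h : P * E = tVar * scaleZ q E) (h0 : coeff 0 E = 1)
    (hE : ∀ k : ℕ, ConvergesAt E (q ^ k)) (m k : ℕ) : ConvAt (q ^ k) (rowSeries T m) := by
  induction m using Nat.strong_induction_on generalizing k with
  | _ m ih =>
    have key := hT.sum_rowSeries h m
    rw [Finset.Nat.sum_antidiagonal_eq_sum_range_succ_mk, sum_range_succ] at key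
    simp only [Nat.sub_self, pow_zero, h0, mul_one, rescale_one, RingHom.id_apply] at key
    rw [eq_sub_of_add_eq' key]
    refine ((convAt_X _).mul ((hE k).coeff m)).sub (ConvAt.sum fun a ha => ?_)
    refine ConvAt.mul (ConvAt.rescale ?_) ((hE k).coeff _)
    rw [← pow_add]
    exact ih a (mem_range.1 ha) _

/-! ### The operator `T` as a conjugate of the gauged operator -/

/-- The operator `F ↦ ∑_i T_i z^{i₁} F(q^{i₂} z)`. -/
def gaugedOp (q : ℂ) (T : ℕ × ℕ → ℂ) : PowerSeries ℂ →ₗ[ℂ] PowerSeries ℂ where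
  toFun F := mk fun m => ∑ x ∈ antidiagonal m, ev (q ^ x.2) (rowSeries T x.1) * coeff x.2 F
  map_add' F G := by
    ext m
    simp [mul_add, sum_add_distrib]
  map_smul' c F := by
    ext m
    simp only [coeff_mk, map_smul, smul_eq_mul, RingHom.id_apply, mul_sum]
    exact sum_congr rfl fun _ _ => by ring

lemma coeff_gaugedOp (q : ℂ) (T : ℕ × ℕ → ℂ) (F : PowerSeries ℂ) (m : ℕ) :
    coeff m (gaugedOp q T F)
      = ∑ x ∈ antidiagonal m, ev (q ^ x.2) (rowSeries T x.1) * coeff x.2 F := by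
  simp [gaugedOp]

lemma X_pow_dvd_gaugedOp (q : ℂ) (T : ℕ × ℕ → ℂ) {F : PowerSeries ℂ} {n : ℕ} (hF : X ^ n ∣ F) :
    X ^ n ∣ gaugedOp q T F := by
  rw [X_pow_dvd_iff] at hF ⊢
  intro m hm
  rw [coeff_gaugedOp]
  refine sum_eq_zero fun x hx => ?_
  rw [hF _ (lt_of_le_of_lt ((Nat.le_add_left _ _).trans (mem_antidiagonal.1 hx).le) hm), mul_zero]

lemma hasSum_gaugedOp {q : ℂ} {T : ℕ × ℕ → ℂ} (hT : ∀ m k, ConvAt (q ^ k) (rowSeries T m))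
    (F : PowerSeries ℂ) (m : ℕ) :
    HasSum (fun i : ℕ × ℕ => coeff m (X ^ i.1 * T i • rescale (q ^ i.2) F))
      (coeff m (gaugedOp q T F)) := by
  rw [coeff_gaugedOp]
  refine hasSum_coeff_X_pow_mul (s := fun a l => ev (q ^ l) (rowSeries T a) * coeff l F) ?_
  intro a l _
  refine ((hT a l).hasSum.mul_right (coeff l F)).congr_fun ?_
  intro b
  simp only [map_smul, smul_eq_mul, coeff_rescale, rowSeries, coeff_mk]
  rw [← pow_mul, ← pow_mul, mul_comm l]
  ring

/-- `gaugedOp` maps `z^k E(z,q^k)` to `q^k` times itself. -/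
lemma gaugedOp_X_pow_mul {q : ℂ} {P E : Series2} {T : ℕ × ℕ → ℂ}
    (hT : IsDualCoefficients q P T) (h : P * E = tVar * scaleZ q E)
    (hE : ∀ k : ℕ, ConvergesAt E (q ^ k))
    (hc : ∀ m k, ConvAt (q ^ k) (rowSeries T m)) (k : ℕ) :
    gaugedOp q T (X ^ k * evalT E (q ^ k)) = q ^ k • (X ^ k * evalT E (q ^ k)) := by
  ext m
  rw [map_smul, smul_eq_mul]
  by_cases hm : m < k
  · have hd := Dvd.intro (evalT E (q ^ k)) (rfl : X ^ k * evalT E (q ^ k) = _)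
    rw [X_pow_dvd_iff.1 (X_pow_dvd_gaugedOp q T hd) m hm, X_pow_dvd_iff.1 hd m hm, mul_zero]
  · obtain ⟨m, rfl⟩ := Nat.exists_eq_add_of_le (not_lt.1 hm)
    have key := congrArg (ev (q ^ k)) (hT.sum_rowSeries h m)
    have hr : ∀ a l, ConvAt (q ^ k) (rescale (q ^ l) (rowSeries T a)) := fun a l =>
      ConvAt.rescale (by rw [← pow_add]; exact hc a _)
    rw [ev_sum fun x _ => (hr _ _).mul ((hE k).coeff _), ev_mul (convAt_X _) ((hE k).coeff _),
      ev_X] at key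
    -- The sum is ordered by the index of the coefficient of `z^k E(z,q^k)`: indices below `k`
    -- contribute nothing, and the others, shifted by `k`, give the functional equation at `t =
    -- q^k`.
    rw [add_comm k m, coeff_X_pow_mul, coeff_evalT, ← key, coeff_gaugedOp,
      ← Finset.Nat.sum_antidiagonal_swap, ← Finset.Nat.sum_antidiagonal_swap (n := m),
      Finset.Nat.sum_antidiagonal_eq_sum_range_succ_mk,
      Finset.Nat.sum_antidiagonal_eq_sum_range_succ_mk, add_comm m k, ← Nat.add_succ,
      sum_range_add, sum_eq_zero, zero_add]
    · refine sum_congr rfl fun l _ => ?_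
      simp only [Prod.fst_swap, Prod.snd_swap]
      rw [ev_mul (hr _ _) ((hE k).coeff _), ev_rescale, ← pow_add, add_comm k l, coeff_X_pow_mul,
        coeff_evalT, add_comm k m, Nat.add_sub_add_right]
    · intro l hl
      simp only [Prod.snd_swap]
      rw [X_pow_dvd_iff.1 (Dvd.intro _ rfl) l (mem_range.1 hl), mul_zero]

lemma evalT_predual_mul {q : ℂ} {P E : Series2} (h : P * E = tVar * scaleZ q E)
    (hP : ConvergesAt P 1) (hE : ConvergesAt E 1) (i : ℕ × ℕ) :
    evalT (predual q P i) 1 * evalT E 1 = X ^ i.1 * rescale (q ^ i.2) (evalT E 1) := by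
  have ht : ConvergesAt (tVar ^ i.2) 1 := by
    rw [tVar, ← map_pow]; exact convergesAt_C (convAt_X_pow 1 _)
  rw [← evalT_mul (hP.predual q i) hE, predual_mul_of_scaleZ h,
    evalT_mul (convergesAt_zVar_pow 1 _) (ht.mul (hE.scaleZ _)), evalT_mul ht (hE.scaleZ _),
    evalT_zVar_pow, evalT_scaleZ, tVar, ← map_pow, evalT_C, ev_X_pow, one_pow, map_one, one_mul]

/-- At `t = 1` the telescoping gives `ẽ_i(z,1) = z^{i₁} E(q^{i₂}z,1) / E(z,1)`, so `T` is the gauged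
operator conjugated by `E(z,1)`. -/
lemma hasSum_opTerm {q : ℂ} {P E : Series2} {T : ℕ × ℕ → ℂ} (h : P * E = tVar * scaleZ q E)
    (hP : ConvergesAt P 1) (hE : ConvergesAt E 1)
    (hc : ∀ m k, ConvAt (q ^ k) (rowSeries T m)) {W : PowerSeries ℂ} (hW : evalT E 1 * W = 1)
    (f : PowerSeries ℂ) (m : ℕ) :
    HasSum (fun i => coeff m (opTerm q P T f i))
      (coeff m (W * gaugedOp q T (evalT E 1 * f))) := by
  have key : ∀ i, opTerm q P T f i
      = W * (X ^ i.1 * T i • rescale (q ^ i.2) (evalT E 1 * f)) := by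
    intro i
    rw [opTerm, map_mul, mul_smul_comm, mul_smul_comm]
    congr 1
    calc _ = evalT (predual q P i) 1 * rescale (q ^ i.2) f * (evalT E 1 * W) := by
          rw [hW, mul_one]
      _ = (evalT (predual q P i) 1 * evalT E 1) * (W * rescale (q ^ i.2) f) := by ring
      _ = _ := by rw [evalT_predual_mul h hP hE]; ring
  simp_rw [key]
  exact HasSum.coeff_mul_left (fun m => hasSum_gaugedOp hc _ m) W m

/-! ### Solutions of `F(qz) = P(z,q^k) F(z)` -/

lemma pow_ne_pow {q : ℂ} (hq0 : q ≠ 0) (hq : ∀ k : ℕ, 0 < k → q ^ k ≠ 1) {m k : ℕ}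
    (hm : m ≠ k) : q ^ m ≠ q ^ k := by
  intro h
  rcases lt_or_gt_of_ne hm with hlt | hlt
  · refine hq (k - m) (Nat.sub_pos_of_lt hlt) ?_
    rw [pow_sub₀ q hq0 hlt.le, h, mul_inv_cancel₀ (pow_ne_zero _ hq0)]
  · refine hq (m - k) (Nat.sub_pos_of_lt hlt) ?_
    rw [pow_sub₀ q hq0 hlt.le, h, mul_inv_cancel₀ (pow_ne_zero _ hq0)]

/-- A solution of `F(qz) = P(z,q^k) F(z)` is a multiple of `z^k E(z,q^k)`. -/
lemma eq_smul_of_rescale_eq {q : ℂ} (hq0 : q ≠ 0) (hq : ∀ k : ℕ, 0 < k → q ^ k ≠ 1)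
    {p G F : PowerSeries ℂ} {k : ℕ} (hG0 : coeff 0 G = 1)
    (hG : p * G = q ^ k • rescale q G) (hF : rescale q F = p * F) :
    F = coeff k F • (X ^ k * G) := by
  have hcc : constantCoeff G ≠ 0 := by
    rw [← coeff_zero_eq_constantCoeff_apply, hG0]; exact one_ne_zero
  obtain ⟨H, rfl⟩ : ∃ H, F = G * H :=
    ⟨G⁻¹ * F, by rw [← mul_assoc, PowerSeries.mul_inv_cancel _ hcc, one_mul]⟩
  have hr : rescale q G ≠ 0 := by
    intro h0
    have := congrArg (coeff 0) h0
    rw [coeff_rescale, hG0] at this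
    simp at this
  -- The quotient `H = F/G` satisfies `H(qz) = q^k H(z)`, so only its `z^k` coefficient can survive.
  have hH : rescale q H = q ^ k • H := by
    apply mul_left_cancel₀ hr
    rw [← map_mul, hF, ← mul_assoc, hG, smul_mul_assoc, mul_smul_comm]
  have hH' : H = coeff k H • X ^ k := by
    ext m
    rw [map_smul, coeff_X_pow, smul_eq_mul]
    split_ifs with hm
    · rw [hm, mul_one]
    · have := congrArg (coeff m) hH
      rw [coeff_rescale, map_smul, smul_eq_mul, ← sub_eq_zero, ← sub_mul] at this
      rw [mul_zero]
      exact (mul_eq_zero.1 this).resolve_left (sub_ne_zero.2 (pow_ne_pow hq0 hq hm))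
  have hk : coeff k (G * H) = coeff k H := by
    rw [hH', mul_smul_comm, map_smul, map_smul, coeff_mul_X_pow', coeff_X_pow_self]
    simp [hG0]
  rw [hk]
  nth_rewrite 1 [hH']
  rw [mul_smul_comm, mul_comm]

/-! ### Triangular families and their dual forms -/

/-- `e_k` has order exactly `k` for all `k`. -/
structure IsTriangular (e : ℕ → PowerSeries ℂ) : Prop where
  coeff_lt : ∀ {k j : ℕ}, j < k → coeff j (e k) = 0
  coeff_self : ∀ k, coeff k (e k) ≠ 0

/-- The coordinates of a power series in a triangular family. -/
def triForm (e : ℕ → PowerSeries ℂ) (n : ℕ) : PowerSeries ℂ →ₗ[ℂ] ℂ :=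
  (coeff n (e n))⁻¹ • (coeff n - ∑ l : Fin n, coeff n (e l) • triForm e l)

lemma IsTriangular.coeff_eq_sum_triForm {e : ℕ → PowerSeries ℂ} (he : IsTriangular e)
    (f : PowerSeries ℂ) (m : ℕ) :
    coeff m f = ∑ l ∈ range (m + 1), triForm e l f * coeff m (e l) := by
  have h : triForm e m f * coeff m (e m)
      = coeff m f - ∑ l ∈ range m, triForm e l f * coeff m (e l) := by
    have h0 := he.coeff_self m
    rw [triForm, Finset.sum_range]
    simp only [LinearMap.smul_apply, LinearMap.sub_apply, LinearMap.sum_apply, smul_eq_mul]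
    rw [mul_comm, ← mul_assoc, mul_inv_cancel₀ h0, one_mul]
    congr 1
    exact sum_congr rfl fun _ _ => mul_comm _ _
  rw [sum_range_succ, h]
  ring

lemma IsTriangular.eq_of_sum_eq {e : ℕ → PowerSeries ℂ} (he : IsTriangular e) {c d : ℕ → ℂ}
    (h : ∀ m, ∑ l ∈ range (m + 1), c l * coeff m (e l)
      = ∑ l ∈ range (m + 1), d l * coeff m (e l)) : c = d := by
  funext m
  induction m using Nat.strong_induction_on with
  | _ m ih =>
    have hm := h m
    rw [sum_range_succ, sum_range_succ,
      sum_congr rfl fun l hl => by rw [ih l (mem_range.1 hl)]] at hm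
    exact mul_right_cancel₀ (he.coeff_self m) (add_left_cancel hm)

lemma IsTriangular.hasSum {e : ℕ → PowerSeries ℂ} (he : IsTriangular e) (c : ℕ → ℂ) (m : ℕ) :
    HasSum (fun n => c n * coeff m (e n)) (∑ l ∈ range (m + 1), c l * coeff m (e l)) := by
  refine hasSum_sum_of_ne_finset_zero fun n hn => ?_
  rw [he.coeff_lt (by simpa using hn), mul_zero]

lemma IsTriangular.isDualForms_triForm {e : ℕ → PowerSeries ℂ} (he : IsTriangular e) :
    IsDualForms e (triForm e) where
  apply_basis n k := by
    have h : (fun n => triForm e n (e k)) = fun n => if k = n then 1 else 0 := by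
      refine he.eq_of_sum_eq fun m => ?_
      rw [← he.coeff_eq_sum_triForm]
      simp only [ite_mul, one_mul, zero_mul, sum_ite_eq, mem_range]
      split_ifs with hk
      · rfl
      · exact he.coeff_lt (by omega)
    exact congrFun h n
  expansion f m := by
    have h := he.hasSum (fun n => triForm e n f) m
    rwa [← he.coeff_eq_sum_triForm] at h

lemma IsTriangular.eq_triForm {e : ℕ → PowerSeries ℂ} (he : IsTriangular e)
    {L : ℕ → PowerSeries ℂ →ₗ[ℂ] ℂ} (hL : IsDualForms e L) : L = triForm e := by
  funext n
  ext f
  refine congrFun (he.eq_of_sum_eq (c := fun n => L n f) (d := fun n => triForm e n f)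
    fun m => ?_) n
  rw [← he.coeff_eq_sum_triForm]
  exact (he.hasSum (fun n => L n f) m).unique (hL.expansion f m)

/-- Preserving the z-adic filtration makes `S` continuous: `[z^m] S f` depends only on the finite
part `∑_{l≤m} c_l e_l`, where linearity suffices. -/
lemma IsTriangular.coeff_apply {e : ℕ → PowerSeries ℂ} (he : IsTriangular e)
    {S : PowerSeries ℂ →ₗ[ℂ] PowerSeries ℂ} (hS : ∀ n F, X ^ n ∣ F → X ^ n ∣ S F)
    {μ : ℕ → ℂ} (hμ : ∀ k, S (e k) = μ k • e k) {c : ℕ → ℂ} {f : PowerSeries ℂ}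
    (hf : ∀ m, coeff m f = ∑ l ∈ range (m + 1), c l * coeff m (e l)) (m : ℕ) :
    coeff m (S f) = ∑ l ∈ range (m + 1), c l * μ l * coeff m (e l) := by
  have hd : X ^ (m + 1) ∣ f - ∑ l ∈ range (m + 1), c l • e l := by
    rw [X_pow_dvd_iff]
    intro j hj
    rw [map_sub, hf j, map_sum, sub_eq_zero]
    simp only [map_smul, smul_eq_mul]
    refine sum_subset (range_mono hj) fun l _ hl => ?_
    rw [he.coeff_lt (by simpa using hl), mul_zero]
  have h := X_pow_dvd_iff.1 (hS _ _ hd) m m.lt_succ_self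
  rw [map_sub, map_sub, sub_eq_zero] at h
  rw [h, map_sum, map_sum]
  refine sum_congr rfl fun l _ => ?_
  rw [map_smul, hμ, map_smul, map_smul, smul_eq_mul, smul_eq_mul, mul_assoc]

lemma IsTriangular.coeff_iterate {e : ℕ → PowerSeries ℂ} (he : IsTriangular e)
    {S : PowerSeries ℂ →ₗ[ℂ] PowerSeries ℂ} (hS : ∀ n F, X ^ n ∣ F → X ^ n ∣ S F)
    {μ : ℕ → ℂ} (hμ : ∀ k, S (e k) = μ k • e k) (f : PowerSeries ℂ) (j m : ℕ) :
    coeff m (S^[j] f) = ∑ l ∈ range (m + 1), triForm e l f * μ l ^ j * coeff m (e l) := by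
  induction j generalizing m with
  | zero => simpa using he.coeff_eq_sum_triForm f m
  | succ j ih =>
    rw [Function.iterate_succ_apply', he.coeff_apply hS hμ ih]
    simp only [pow_succ, mul_assoc]

/-! ### Action of `ΔP(z,T,q^n)` on the basis -/

/-- The divided difference `(P(z,q^l) - P(z,q^n)) / (q^l - q^n)`, replaced by `1` for `l = n`. -/
def divDiff (q : ℂ) (P : Series2) (n l : ℕ) : PowerSeries ℂ :=
  if l = n then 1 else (q ^ l - q ^ n)⁻¹ • (evalT P (q ^ l) - evalT P (q ^ n))

lemma sum_antidiagonal_pow_mul_sub (x y : ℂ) (N : ℕ) :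
    (∑ jk ∈ antidiagonal N, y ^ jk.2 * x ^ jk.1) * (x - y) = x ^ (N + 1) - y ^ (N + 1) := by
  rw [← (Commute.all x y).geom_sum₂_mul, Finset.Nat.sum_antidiagonal_eq_sum_range_succ_mk]
  congr 1
  refine sum_congr rfl fun j hj => ?_
  rw [mul_comm, Nat.add_sub_cancel]

/-- For `l ≠ n` this is the geometric sum for `(x^{N+1} - y^{N+1})/(x - y)`. For `l = n` only the
row `a = 0` is claimed, where `P(0,t) = t` leaves the single term `N = 0`; no derivative of `P` has
to converge. -/
lemma hasSum_divDiff {q : ℂ} (hq0 : q ≠ 0) (hq : ∀ k : ℕ, 0 < k → q ^ k ≠ 1) {P : Series2}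
    (hP : IsCatalan P) (hc : ∀ k : ℕ, ConvergesAt P (q ^ k)) {n l a : ℕ} (ha : l = n → a = 0) :
    HasSum (fun N => coeff2 a (N + 1) P *
        ∑ jk ∈ antidiagonal N, (q ^ n) ^ jk.2 * (q ^ l) ^ jk.1)
      (coeff a (divDiff q P n l)) := by
  by_cases hl : l = n
  · have h0 := ha hl
    subst h0
    rw [divDiff, if_pos hl]
    have hcf : ∀ N, coeff2 0 (N + 1) P = if N = 0 then 1 else 0 := by
      intro N
      rw [coeff2, hP.coeff_zero, coeff_X]
      simp
    convert hasSum_single 0 fun N hN => ?_ using 1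
    · simp [hcf]
    · rw [hcf, if_neg hN, zero_mul]
  · have hne := sub_ne_zero.2 (pow_ne_pow hq0 hq hl)
    have hs : ∀ k : ℕ, HasSum (fun N => coeff2 a (N + 1) P * (q ^ k) ^ (N + 1))
        (coeff a (evalT P (q ^ k))) := by
      intro k
      -- The shift to `N + 1` loses nothing because `P(z,0) = 0`.
      rw [hasSum_nat_add_iff (f := fun b => coeff2 a b P * (q ^ k) ^ b) 1]
      simp only [sum_range_one, hP.coeff2_zero, zero_mul, add_zero, evalT, coeff_mk]
      exact (hc k a).hasSum
    rw [divDiff, if_neg hl, map_smul, map_sub, smul_eq_mul]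
    refine (((hs l).sub (hs n)).mul_left _).congr_fun fun N => ?_
    rw [← mul_sub, ← sum_antidiagonal_pow_mul_sub]
    field_simp

lemma hasSum_substTerm {q : ℂ} (hq0 : q ≠ 0) (hq : ∀ k : ℕ, 0 < k → q ^ k ≠ 1) {P : Series2}
    (hP : IsCatalan P) (hc : ∀ k : ℕ, ConvergesAt P (q ^ k)) {e : ℕ → PowerSeries ℂ}
    (he : IsTriangular e) {S : PowerSeries ℂ →ₗ[ℂ] PowerSeries ℂ}
    (hS : ∀ n F, X ^ n ∣ F → X ^ n ∣ S F) (hμ : ∀ k, S (e k) = q ^ k • e k)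
    (f : PowerSeries ℂ) {m n : ℕ} (hmn : m ≤ n) :
    HasSum (fun p => coeff m (substTerm (deltaP P) S (q ^ n) f p))
      (coeff m (∑ l ∈ range (n + 1), triForm e l f • (divDiff q P n l * e l))) := by
  have hval : coeff m (∑ l ∈ range (n + 1), triForm e l f • (divDiff q P n l * e l))
      = ∑ x ∈ antidiagonal m, ∑ l ∈ range (x.2 + 1),
        triForm e l f * coeff x.2 (e l) * coeff x.1 (divDiff q P n l) := by
    simp only [map_sum, map_smul, smul_eq_mul, coeff_mul, mul_sum]
    rw [sum_comm]
    refine sum_congr rfl fun x hx => ?_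
    have hx' := mem_antidiagonal.1 hx
    rw [← sum_subset (range_mono (show x.2 + 1 ≤ n + 1 by omega)) fun l _ hl => by
      rw [he.coeff_lt (by simpa using hl), mul_zero, mul_zero]]
    exact sum_congr rfl fun _ _ => by ring
  rw [hval]
  unfold substTerm
  refine hasSum_coeff_X_pow_mul (s := fun a b => ∑ l ∈ range (b + 1),
    triForm e l f * coeff b (e l) * coeff a (divDiff q P n l)) fun a b hab => ?_
  have hterm : ∀ N, coeff b (∑ jk ∈ antidiagonal N,
      (coeff3 a jk.1 jk.2 (deltaP P) * (q ^ n) ^ jk.2) • (S^[jk.1] f))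
      = ∑ l ∈ range (b + 1), triForm e l f * coeff b (e l) * (coeff2 a (N + 1) P *
        ∑ jk ∈ antidiagonal N, (q ^ n) ^ jk.2 * (q ^ l) ^ jk.1) := by
    intro N
    simp only [map_sum, map_smul, smul_eq_mul, mul_sum]
    rw [sum_comm]
    refine sum_congr rfl fun jk hjk => ?_
    rw [he.coeff_iterate hS hμ, mul_sum]
    refine sum_congr rfl fun l _ => ?_
    simp only [coeff3, deltaP, coeff_mk, mem_antidiagonal.1 hjk]
    ring
  simp_rw [hterm]
  -- Here `l ≤ b` and `a + b = m ≤ n`, so `l = n` forces `a = 0`.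
  refine hasSum_sum fun l hl => (hasSum_divDiff hq0 hq hP hc fun hln => ?_).mul_left _
  have := mem_range.1 hl
  omega

/-! ### Constant terms of Laurent quotients -/

lemma laurent_coe_ne_zero {g : PowerSeries ℂ} (hg : g ≠ 0) : (g : LaurentSeries ℂ) ≠ 0 := by
  rw [Ne, ← map_zero (HahnSeries.ofPowerSeries ℤ ℂ), HahnSeries.ofPowerSeries_injective.eq_iff]
  exact hg

/-- The constant term of a quotient `s / (z^n v)` of Laurent series. -/
lemma coeff_zero_div_X_pow_mul {n : ℕ} {s v w : PowerSeries ℂ} (hvw : v * w = 1) :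
    HahnSeries.coeff ((s : LaurentSeries ℂ) / ((X ^ n * v : PowerSeries ℂ) : LaurentSeries ℂ)) 0
      = coeff n (s * w) := by
  have hv : v ≠ 0 := left_ne_zero_of_mul_eq_one hvw
  have hne : ((X ^ n * v : PowerSeries ℂ) : LaurentSeries ℂ) ≠ 0 := by
    exact laurent_coe_ne_zero (mul_ne_zero (pow_ne_zero _ X_ne_zero) hv)
  have h : (s : LaurentSeries ℂ) / ((X ^ n * v : PowerSeries ℂ) : LaurentSeries ℂ)
      = HahnSeries.single (-(n : ℤ)) 1 * ((s * w : PowerSeries ℂ) : LaurentSeries ℂ) := by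
    rw [div_eq_iff hne, mul_assoc, ← PowerSeries.coe_mul]
    have : s * w * (X ^ n * v) = X ^ n * s := by
      calc _ = X ^ n * s * (v * w) := by ring
        _ = _ := by rw [hvw, mul_one]
    rw [this, PowerSeries.coe_mul, PowerSeries.coe_pow, PowerSeries.coe_X, ← mul_assoc,
      HahnSeries.single_pow, HahnSeries.single_mul_single]
    simp
  rw [h]
  have := HahnSeries.coeff_single_mul_add (r := (1 : ℂ))
    (x := ((s * w : PowerSeries ℂ) : LaurentSeries ℂ)) (a := (n : ℤ)) (b := -(n : ℤ))
  rw [add_neg_cancel] at this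
  rw [this, one_mul, LaurentSeries.coeff_coe_powerSeries]

lemma coeff_mul_congr {n : ℕ} {s r : PowerSeries ℂ} (h : ∀ m ≤ n, coeff m s = coeff m r)
    (w : PowerSeries ℂ) : coeff n (s * w) = coeff n (r * w) := by
  rw [coeff_mul, coeff_mul]
  refine sum_congr rfl fun x hx => ?_
  rw [h _ ((Nat.le_add_right _ _).trans (mem_antidiagonal.1 hx).le)]

lemma exists_mul_eq_one {g : PowerSeries ℂ} (hg : coeff 0 g ≠ 0) : ∃ w, g * w = 1 :=
  ⟨g⁻¹, PowerSeries.mul_inv_cancel g (by rwa [coeff_zero_eq_constantCoeff_apply] at hg)⟩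

lemma IsCatalan.coeff_zero_evalT {P : Series2} (hP : IsCatalan P) (c : ℂ) :
    coeff 0 (evalT P c) = c := by
  rw [coeff_evalT, hP.coeff_zero, ev_X]

/-- The Laurent quotient extracts the `n`-th coordinate. -/
lemma IsTriangular.triForm_eq {q : ℂ} (hq0 : q ≠ 0)
    {P : Series2} (hP : IsCatalan P) {e : ℕ → PowerSeries ℂ} (he : IsTriangular e)
    (hr : ∀ k, rescale q (e k) * evalT P 1 = evalT P (q ^ k) * e k) (n : ℕ)
    (f s : PowerSeries ℂ)
    (hs : ∀ m ≤ n, coeff m s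
      = coeff m (∑ l ∈ range (n + 1), triForm e l f • (divDiff q P n l * e l))) :
    triForm e n f = q ^ n * HahnSeries.coeff ((s : LaurentSeries ℂ) /
      (((rescale q (e n) : PowerSeries ℂ) : LaurentSeries ℂ)
        * (evalT P 1 : LaurentSeries ℂ))) 0 := by
  have hqn : q ^ n ≠ 0 := pow_ne_zero n hq0
  obtain ⟨W, hW⟩ : X ^ n ∣ e n := X_pow_dvd_iff.2 fun m hm => he.coeff_lt hm
  have hW0 : coeff 0 W ≠ 0 := by
    have := he.coeff_self n
    rw [hW] at this
    rwa [coeff_X_pow_mul', if_pos le_rfl, Nat.sub_self] at this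
  obtain ⟨W', hW'⟩ := exists_mul_eq_one hW0
  have hp0 := hP.coeff_zero_evalT (q ^ n)
  obtain ⟨p', hp'⟩ := exists_mul_eq_one (hp0.trans_ne hqn)
  set p := evalT P (q ^ n) with hp
  have hV : p * W * (p' * W') = 1 := by
    calc _ = (p * p') * (W * W') := by ring
      _ = 1 := by rw [hp', hW', one_mul]
  -- The equation for `e_n = z^n W` after cancelling `z^n`; the factor `q^n` comes from `(qz)^n`.
  have hV2 : p * W = q ^ n • (rescale q W * evalT P 1) := by
    have hX : (X ^ n : PowerSeries ℂ) ≠ 0 := pow_ne_zero _ X_ne_zero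
    apply mul_left_cancel₀ hX
    have h := hr n
    rw [hW, map_mul, map_pow, rescale_X, mul_pow, ← map_pow] at h
    rw [smul_eq_C_mul]
    linear_combination -h
  have hW'' : rescale q W * rescale q W' = 1 := by rw [← map_mul, hW', map_one]
  have hq' : C (q ^ n) * C ((q ^ n)⁻¹) = (1 : PowerSeries ℂ) := by
    rw [← map_mul, mul_inv_cancel₀ hqn, map_one]
  rw [← PowerSeries.coe_mul, hr n, ← hp, hW, ← mul_assoc, mul_comm p, mul_assoc,
    coeff_zero_div_X_pow_mul hV, coeff_mul_congr hs, sum_mul, map_sum,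
    sum_range_succ, sum_eq_zero, zero_add]
  · rw [smul_mul_assoc, map_smul, divDiff, if_pos rfl, one_mul, hW, smul_eq_mul]
    have h1 : X ^ n * W * (p' * W') = X ^ n * p' := by
      linear_combination X ^ n * p' * hW'
    have h2 : q ^ n * coeff 0 p' = 1 := by
      have := congrArg (coeff 0) hp'
      rw [coeff_mul] at this
      simpa [← hp0] using this
    rw [h1]
    rw [coeff_X_pow_mul', if_pos le_rfl, Nat.sub_self]
    linear_combination (-triForm e n f) * h2
  · intro l hl
    have hln : l ≠ n := (mem_range.1 hl).ne
    rw [smul_mul_assoc, map_smul, divDiff, if_neg hln, smul_mul_assoc, smul_mul_assoc,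
      map_smul]
    -- Up to the factor `z^n` this is `g(qz) - g(z)` with `g = e_l/e_n`: in the coefficient of
    -- `z^n`, the `q^n` from rescaling cancels `q^{-n}`.
    have key : (evalT P (q ^ l) - p) * e l * (p' * W')
        = C ((q ^ n)⁻¹) * rescale q (e l * W') - e l * W' := by
      rw [smul_eq_C_mul] at hV2
      have h3 : evalT P 1 * (p' * W') = C ((q ^ n)⁻¹) * rescale q W' := by
        have : C (q ^ n) * rescale q W * (evalT P 1 * (p' * W')) = 1 := by
          rw [← hV, hV2]; ring
        linear_combination C ((q ^ n)⁻¹) * rescale q W' * this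
          - evalT P 1 * (p' * W') * hW''
          - evalT P 1 * (p' * W') * rescale q W * rescale q W' * hq'
      rw [map_mul]
      linear_combination rescale q (e l) * h3 - p' * W' * hr l - e l * W' * hp'
    rw [key, map_sub, coeff_C_mul, coeff_rescale, ← mul_assoc, inv_mul_cancel₀ hqn, one_mul,
      sub_self, smul_zero, smul_zero]

lemma IsQCatalanBasis.rescale_mul_evalT {q : ℂ} {P : Series2} {e : ℕ → PowerSeries ℂ}
    (he : IsQCatalanBasis q P e) (k : ℕ) :
    rescale q (e k) * evalT P 1 = evalT P (q ^ k) * e k := by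
  have hp : evalT P 1 ≠ 0 := by
    intro h
    have := he.catalan.coeff_zero_evalT 1
    rw [h, map_zero] at this
    exact zero_ne_one this
  have h := he.ratio k
  rw [div_eq_div_iff (laurent_coe_ne_zero (he.ne_zero k)) (laurent_coe_ne_zero hp),
    ← PowerSeries.coe_mul, ← PowerSeries.coe_mul] at h
  exact HahnSeries.ofPowerSeries_injective h

/-- The functional equation of the gauge `E`, evaluated at `t = c`. -/
lemma evalT_mul_evalT_of_scaleZ {q c : ℂ} {P E : Series2} (h : P * E = tVar * scaleZ q E)
    (hP : ConvergesAt P c) (hE : ConvergesAt E c) :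
    evalT P c * evalT E c = c • rescale q (evalT E c) := by
  rw [← evalT_mul hP hE, h, tVar, evalT_mul (convergesAt_C (convAt_X c)) (hE.scaleZ q), evalT_C,
    evalT_scaleZ, ev_X, smul_eq_C_mul]

end QCatalan

end

/-! ### The theorem -/

open QCatalan PowerSeries in
theorem theorem2p10 (q : ℂ) (hq0 : q ≠ 0) (hq : ∀ k : ℕ, 0 < k → q ^ k ≠ 1)
    (P : QCatalan.Series2) (e : ℕ → PowerSeries ℂ) (he : QCatalan.IsQCatalanBasis q P e)
    (T : ℕ × ℕ → ℂ) (hT : QCatalan.IsDualCoefficients q P T) :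
    -- the series defining `T f` converges, coefficient by coefficient
    (∀ (f : PowerSeries ℂ) (m : ℕ),
      Summable fun i : ℕ × ℕ => PowerSeries.coeff m (QCatalan.opTerm q P T f i)) ∧
    -- so do the coefficients of order at most `n` of `ΔP(z,T,q^n) f`
    (∀ (n : ℕ) (f : PowerSeries ℂ) (m : ℕ), m ≤ n →
      Summable fun p : ℕ × ℕ => PowerSeries.coeff m
        (QCatalan.substTerm (QCatalan.deltaP P) (QCatalan.opT q P T) (q ^ n) f p)) ∧
    -- the dual forms exist, are unique, and are given by the formula
    (∃! L : ℕ → PowerSeries ℂ →ₗ[ℂ] ℂ, QCatalan.IsDualForms e L) ∧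
    (∀ L : ℕ → PowerSeries ℂ →ₗ[ℂ] ℂ, QCatalan.IsDualForms e L →
      ∀ (n : ℕ) (f : PowerSeries ℂ),
        L n f = q ^ n * HahnSeries.coeff
          ((QCatalan.substOp (QCatalan.deltaP P) (QCatalan.opT q P T) (q ^ n) f : LaurentSeries ℂ)
            / (((PowerSeries.rescale q (e n) : PowerSeries ℂ) : LaurentSeries ℂ)
                * (QCatalan.evalT P 1 : LaurentSeries ℂ))) 0) := by
  have hcat := he.catalan
  have hconv := he.converges
  have hP1 : ConvergesAt P 1 := by simpa using hconv 0
  let E : Series2 := qSol q (divT P)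
  have hE0 : coeff 0 E = 1 := coeff_zero_qSol q _
  have hPE : P * E = tVar * scaleZ q E := by
    rw [scaleZ_qSol hq hcat.coeff_zero_divT, ← mul_assoc, hcat.tVar_mul_divT]
  have hE : ∀ k : ℕ, ConvergesAt E (q ^ k) := fun k =>
    ((hconv k).divT (pow_ne_zero k hq0)).qSol
  have hE1 : ConvergesAt E 1 := by simpa using hE 0
  have hEc : ∀ c, coeff 0 (evalT E c) = 1 := fun c => by rw [coeff_evalT, hE0, ev_one]
  have hrow : ∀ m k, ConvAt (q ^ k) (rowSeries T m) := hT.convAt hPE hE0 hE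
  obtain ⟨W, hW⟩ := exists_mul_eq_one ((hEc 1).trans_ne one_ne_zero)
  have hsum : ∀ f m, HasSum (fun i => coeff m (opTerm q P T f i))
      (coeff m (W * gaugedOp q T (evalT E 1 * f))) := hasSum_opTerm hPE hP1 hE1 hrow hW
  let S : PowerSeries ℂ →ₗ[ℂ] PowerSeries ℂ :=
    LinearMap.mulLeft ℂ W ∘ₗ gaugedOp q T ∘ₗ LinearMap.mulLeft ℂ (evalT E 1)
  have hS : ∀ f, S f = W * gaugedOp q T (evalT E 1 * f) := fun _ => rfl
  have hopT : opT q P T = S := by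
    funext f
    ext m
    rw [opT, coeff_mk, hS]
    exact (hsum f m).tsum_eq
  have hSdvd : ∀ n F, X ^ n ∣ F → X ^ n ∣ S F := fun n F hF =>
    (X_pow_dvd_gaugedOp q T (hF.mul_left _)).mul_left _
  have hr := he.rescale_mul_evalT
  have hF : ∀ k, evalT E 1 * e k
      = coeff k (evalT E 1 * e k) • (X ^ k * evalT E (q ^ k)) := fun k => by
    refine eq_smul_of_rescale_eq hq0 hq (p := evalT P (q ^ k)) (hEc _)
      (evalT_mul_evalT_of_scaleZ hPE (hconv k) (hE k)) ?_
    have h1 := evalT_mul_evalT_of_scaleZ hPE hP1 hE1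
    rw [one_smul] at h1
    rw [map_mul, ← h1]
    linear_combination evalT E 1 * hr k
  -- Dividing by `E(z,1)`: `e_k` is a scalar times `z^k` times a series with constant term 1, the
  -- scalar being nonzero since `e_k ≠ 0`.
  have hek : ∀ k, e k = coeff k (evalT E 1 * e k) • (X ^ k * (W * evalT E (q ^ k))) := fun k => by
    calc e k = W * (evalT E 1 * e k) := by rw [← mul_assoc, mul_comm W, hW, one_mul]
      _ = _ := by rw [hF k, mul_smul_comm, mul_left_comm, ← hF k]
  have hμ : ∀ k, S (e k) = q ^ k • e k := fun k => by
    rw [hS, hF, map_smul, gaugedOp_X_pow_mul hT hPE hE hrow, smul_comm, mul_smul_comm, ← hF,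
      ← mul_assoc, mul_comm W, hW, one_mul]
  have hW0 : coeff 0 W = 1 := by
    have h := congrArg (coeff 0) hW
    rw [coeff_mul] at h
    simpa [hEc] using h
  have hG : ∀ k, coeff 0 (W * evalT E (q ^ k)) = 1 := fun k => by
    rw [coeff_zero_eq_constantCoeff_apply, map_mul, ← coeff_zero_eq_constantCoeff_apply,
      ← coeff_zero_eq_constantCoeff_apply, hW0, hEc, one_mul]
  have htri : IsTriangular e :=
    { coeff_lt := fun {k j} hj => by
        rw [hek k, map_smul, X_pow_dvd_iff.1 (Dvd.intro _ rfl) j hj, smul_zero]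
      coeff_self := fun k hk => he.ne_zero k (by
        rw [hek k, map_smul, coeff_X_pow_mul', if_pos le_rfl, Nat.sub_self, hG, smul_eq_mul,
          mul_one] at hk
        rw [hek k, hk, zero_smul]) }
  have hsubst := fun f m n (hmn : m ≤ n) =>
    hasSum_substTerm hq0 hq hcat hconv htri hSdvd hμ f hmn
  rw [hopT]
  refine ⟨fun f m => (hsum f m).summable, fun n f m hmn => (hsubst f m n hmn).summable,
    ⟨triForm e, htri.isDualForms_triForm, fun L hL => htri.eq_triForm hL⟩, ?_⟩
  intro L hL n f
  rw [htri.eq_triForm hL]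
  refine htri.triForm_eq hq0 hcat hr n f _ fun m hm => ?_
  rw [substOp, coeff_mk]
  exact (hsubst f m n hm).tsum_eq
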